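/- Let $d\ge 2$, let $X=\{1,\dots,d\}$, and let $T$ be the $d$-regular rooted tree whose vertices are the finite words over $X$, the root being the empty word and the children of a word $v$ being the words $vx$ with $x\in X$. Let $\operatorname{Aut}(T)$ be the group of automorphisms of $T$ fixing the root, with the topology in which the stabilizers $\operatorname{St}(n)$ of the levels $n\in\mathbb N$ (the pointwise stabilizers of the sets of words of length $n$) form a base of neighbourhoods of the identity. For $g\in\operatorname{Aut}(T)$ and a vertex $v$ let $g|_v^1\in\operatorname{Sym}(d)$ be the permutation determined by $g(vx)=g(v)\,g|_v^1(x)$ for all $x\in X$. Let $1\neq\mathcal Q\lhd\mathcal P\le\operatorname{Sym}(d)$, and let $$G_{\mathcal Q}^{\mathcal P}=\{g\in\operatorname{Aut}(T): g|_v^1\in\mathcal P \text{ and } (g|_v^1)(g|_w^1)^{-1}\in\mathcal Q \text{ for all vertices } v,w \text{ of } T\},$$ a closed subgroup of $\operatorname{Aut}(T)$, with the subspace topology. Call it topologically finitely generated if it contains a finitely generated dense subgroup, and let $\mathcal Q'$ denote the commutator subgroup of $\mathcal Q$. 1. If $\mathcal Q\neq\mathcal Q'$, or if there is $x\in X$ with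 $q(x)=x$ for all $q\in\mathcal Q$, then $G_{\mathcal Q}^{\mathcal P}$ is not topologically finitely generated. 2. If $\mathcal Q$ is transitive on $X$, then $G_{\mathcal Q}^{\mathcal P}$ is topologically finitely generated if and only if $\mathcal Q=\mathcal Q'$. -/

import Mathlib

/-- The `d`-regular rooted tree, with words over `{0, …, d-1}` as vertices and the empty word as
root: the children of a word `v` are the words `v x` with `x` a letter. -/
def regTree (d : ℕ) : SimpleGraph (List (Fin d)) where
  Adj v w := (∃ x, w = v ++ [x]) ∨ (∃ x, v = w ++ [x])
  symm := ⟨fun _ _ h => h.symm⟩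
  loopless := ⟨fun v h => by rcases h with ⟨x, h⟩ | ⟨x, h⟩ <;> simpa using congrArg List.length h⟩

/-- `Aut(T)`: the bijections of the vertex set that preserve adjacency and fix the root.
The product is composition, `(g * h) v = g (h v)`. -/
def AutT (d : ℕ) : Subgroup (regTree d ≃g regTree d) where
  carrier := {g | g [] = []}
  one_mem' := rfl
  mul_mem' := by
    intro g h hg hh
    change g (h []) = []
    rw [show h [] = [] from hh]
    exact hg
  inv_mem' := by
    intro g hg
    change g.symm [] = []
    rw [RelIso.symm_apply_eq]
    exact (show g [] = [] from hg).symm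

namespace AutT

variable {d : ℕ}

theorem root (g : AutT d) : g.1 [] = [] := g.2

theorem mul_app (g h : AutT d) (v : List (Fin d)) : (g * h).1 v = g.1 (h.1 v) := rfl

theorem inv_app_self (g : AutT d) (v : List (Fin d)) : (g⁻¹).1 (g.1 v) = v :=
  g.1.symm_apply_apply v

theorem app_inv_self (g : AutT d) (v : List (Fin d)) : g.1 ((g⁻¹).1 v) = v :=
  g.1.apply_symm_apply v

/-- A root-preserving automorphism maps the children of `v` to children of `g v`. -/
theorem exists_child (g : AutT d) (v : List (Fin d)) :
    ∀ x, ∃ y, g.1 (v ++ [x]) = g.1 v ++ [y] := by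
  induction v using List.reverseRecOn with
  | nil =>
    intro x
    have h : (regTree d).Adj (g.1 []) (g.1 ([] ++ [x])) :=
      g.1.map_rel_iff.2 (Or.inl ⟨x, rfl⟩)
    rcases h with h | ⟨y, h⟩
    · exact h
    · rw [root] at h
      simpa using congrArg List.length h
  | append_singleton u z ih =>
    intro x
    have h : (regTree d).Adj (g.1 (u ++ [z])) (g.1 (u ++ [z] ++ [x])) :=
      g.1.map_rel_iff.2 (Or.inl ⟨x, rfl⟩)
    rcases h with h | ⟨y, h⟩
    · exact h
    · obtain ⟨t, ht⟩ := ih z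
      rw [ht] at h
      have h2 := g.1.injective (List.append_inj_left' h rfl)
      simpa using congrArg List.length h2

/-- The underlying map of the label of `g` at `v`. -/
noncomputable def labelFun (g : AutT d) (v : List (Fin d)) (x : Fin d) : Fin d :=
  (exists_child g v x).choose

theorem labelFun_spec (g : AutT d) (v : List (Fin d)) (x : Fin d) :
    g.1 (v ++ [x]) = g.1 v ++ [labelFun g v x] :=
  (exists_child g v x).choose_spec

theorem labelFun_injective (g : AutT d) (v : List (Fin d)) :
    Function.Injective (labelFun g v) := by
  intro x y hxy
  have h : g.1 (v ++ [x]) = g.1 (v ++ [y]) := by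
    rw [labelFun_spec, labelFun_spec, hxy]
  simpa using g.1.injective h

/-- The label `g|_v^1` of `g` at the vertex `v`: the permutation of the letters with
`g (v x) = g v (g|_v^1 x)`. -/
noncomputable def label (g : AutT d) (v : List (Fin d)) : Equiv.Perm (Fin d) :=
  Equiv.ofBijective (labelFun g v) (Finite.injective_iff_bijective.1 (labelFun_injective g v))

theorem label_spec (g : AutT d) (v : List (Fin d)) (x : Fin d) :
    g.1 (v ++ [x]) = g.1 v ++ [label g v x] := labelFun_spec g v x

theorem label_eq (g : AutT d) (v : List (Fin d)) (σ : Equiv.Perm (Fin d))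
    (h : ∀ x, g.1 (v ++ [x]) = g.1 v ++ [σ x]) : label g v = σ := by
  ext x
  have h1 := (label_spec g v x).symm.trans (h x)
  simp only [List.append_cancel_left_eq, List.cons.injEq, and_true] at h1
  rw [h1]

theorem label_one (v : List (Fin d)) : label (1 : AutT d) v = 1 :=
  label_eq _ _ _ fun _ => rfl

theorem label_mul (g h : AutT d) (v : List (Fin d)) :
    label (g * h) v = label g (h.1 v) * label h v :=
  label_eq _ _ _ fun x => by
    rw [mul_app, mul_app, label_spec, label_spec]; rfl

theorem label_inv (g : AutT d) (v : List (Fin d)) :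
    label g⁻¹ v = (label g ((g⁻¹).1 v))⁻¹ := by
  have h := label_mul g g⁻¹ v
  rw [mul_inv_cancel, label_one] at h
  exact eq_inv_of_mul_eq_one_right h.symm

theorem length_app (g : AutT d) (v : List (Fin d)) : (g.1 v).length = v.length := by
  induction v using List.reverseRecOn with
  | nil => rw [root]
  | append_singleton u z ih => rw [label_spec]; simp [ih]

/-- The stabilizer `St(n)` of the level `n`. -/
def levelStab (d n : ℕ) : Subgroup (AutT d) where
  carrier := {g | ∀ v : List (Fin d), v.length = n → g.1 v = v}
  one_mem' := fun _ _ => rfl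
  mul_mem' := by
    intro g h hg hh v hv
    rw [mul_app, hh v hv, hg v hv]
  inv_mem' := by
    intro g hg v hv
    have h := inv_app_self g v
    rwa [hg v hv] at h

theorem levelStab_normal (d n : ℕ) : (levelStab d n).Normal where
  conj_mem := by
    intro h hh g v hv
    rw [mul_app, mul_app, hh _ ((length_app _ _).trans hv), app_inv_self]

theorem levelStab_succ_le (d n : ℕ) : levelStab d (n + 1) ≤ levelStab d n := by
  intro g hg v hv
  rcases Nat.eq_zero_or_pos d with rfl | hd
  · have : v = [] := by
      cases v with
      | nil => rfl
      | cons x _ => exact x.elim0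
    rw [this, root]
  · have h := hg (v ++ [⟨0, hd⟩]) (by simp [hv])
    rw [label_spec] at h
    exact List.append_inj_left' h rfl

theorem levelStab_antitone (d : ℕ) : Antitone (levelStab d) :=
  antitone_nat_of_succ_le (levelStab_succ_le d)

/-- The level stabilizers as a base of neighbourhoods of the identity. -/
@[reducible] def levelBasis (d : ℕ) : GroupFilterBasis (AutT d) where
  sets := Set.range fun n => (levelStab d n : Set (AutT d))
  nonempty := Set.range_nonempty _
  inter_sets := by
    rintro _ _ ⟨m, rfl⟩ ⟨n, rfl⟩
    exact ⟨_, ⟨max m n, rfl⟩, Set.subset_inter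
      (levelStab_antitone d (le_max_left m n)) (levelStab_antitone d (le_max_right m n))⟩
  one' := by
    rintro _ ⟨n, rfl⟩
    exact (levelStab d n).one_mem
  mul' := by
    rintro _ ⟨n, rfl⟩
    refine ⟨_, ⟨n, rfl⟩, ?_⟩
    rintro _ ⟨g, hg, h, hh, rfl⟩
    exact (levelStab d n).mul_mem hg hh
  inv' := by
    rintro _ ⟨n, rfl⟩
    exact ⟨_, ⟨n, rfl⟩, fun g hg => (levelStab d n).inv_mem hg⟩
  conj' := by
    rintro g _ ⟨n, rfl⟩
    exact ⟨_, ⟨n, rfl⟩, fun h hh => (levelStab_normal d n).conj_mem h hh g⟩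

/-- The topological group `Aut(T)`, with the level stabilizers as a base of neighbourhoods of the
identity. -/
instance instTopologicalSpace (d : ℕ) : TopologicalSpace (AutT d) := (levelBasis d).topology

instance instIsTopologicalGroup (d : ℕ) : IsTopologicalGroup (AutT d) :=
  (levelBasis d).isTopologicalGroup

end AutT

/-- The group `G_Q^P` of the automorphisms of the `d`-regular rooted tree whose labels all lie in
`P`, and in one and the same coset of `Q`. -/
def GQP {d : ℕ} (Q P : Subgroup (Equiv.Perm (Fin d))) (hN : (Q.subgroupOf P).Normal) :
    Subgroup (AutT d) where
  carrier := {g | (∀ v, AutT.label g v ∈ P) ∧ ∀ v w, AutT.label g v * (AutT.label g w)⁻¹ ∈ Q}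
  one_mem' := by simp [AutT.label_one, Q.one_mem, P.one_mem]
  mul_mem' := by
    rintro g h ⟨hg, hg'⟩ ⟨hh, hh'⟩
    refine ⟨fun v => ?_, fun v w => ?_⟩
    · rw [AutT.label_mul]
      exact P.mul_mem (hg _) (hh _)
    · rw [AutT.label_mul, AutT.label_mul]
      have h1 := hN.conj_mem ⟨AutT.label h v * (AutT.label h w)⁻¹, P.mul_mem (hh v) (P.inv_mem (hh w))⟩
        (hh' v w) ⟨AutT.label g (h.1 v), hg _⟩
      have h2 := Q.mul_mem (show AutT.label g (h.1 v) * (AutT.label h v * (AutT.label h w)⁻¹) *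
        (AutT.label g (h.1 v))⁻¹ ∈ Q from h1) (hg' (h.1 v) (h.1 w))
      convert h2 using 1
      group
  inv_mem' := by
    rintro g ⟨hg, hg'⟩
    refine ⟨fun v => ?_, fun v w => ?_⟩
    · rw [AutT.label_inv]
      exact P.inv_mem (hg _)
    · rw [AutT.label_inv, AutT.label_inv, inv_inv]
      set a := AutT.label g ((g⁻¹).1 v)
      set b := AutT.label g ((g⁻¹).1 w)
      have ha : a ∈ P := hg _
      have hb : b ∈ P := hg _
      have h1 := hN.conj_mem ⟨b * a⁻¹, P.mul_mem hb (P.inv_mem ha)⟩ (hg' _ _) ⟨a⁻¹, P.inv_mem ha⟩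
      have h2 : a⁻¹ * (b * a⁻¹) * (a⁻¹)⁻¹ ∈ Q := h1
      convert h2 using 1
      group

/-- A topological group is topologically finitely generated if it contains a finitely generated
dense subgroup. -/
def TopFG (G : Type*) [Group G] [TopologicalSpace G] : Prop :=
  ∃ H : Subgroup G, H.FG ∧ Dense (H : Set G)

/-! Up to finite index the group is `labelled Q`, the iterated permutational wreath product of `Q`.

Obstruction: suppose this subgroup has infinitely many distinct homomorphisms to one finite group,
each killing some level stabilizer. A finitely generated group has only finitely many homomorphisms
to a finite group, so two of them agree on the trace of a finitely generated dense subgroup, hence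
everywhere, a contradiction (`not_topFG_of_homs`). If `Q` is not perfect, take the product of the
labels of a level in the abelianization of `Q`; if `Q` fixes a letter `x`, take the label at the
fixed vertex `xⁿ`.

Construction: for `Q` perfect and transitive, finitely many rooted and spinal elements generate a
group that contains all rooted elements of `Q` and a copy of itself below every letter
(`below_mem_closure`). Such a group is dense in `labelled Q` (`exists_approx`). The constant
labellings by elements of `P` supply the missing cosets. -/

namespace AutT

variable {d : ℕ}

/-! ### Automorphisms and their labels, sections and density. -/

theorem ext_label {g h : AutT d} (H : ∀ v, label g v = label h v) : g = h := by
  have key : ∀ v, g.1 v = h.1 v := by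
    intro v
    induction v using List.reverseRecOn with
    | nil => rw [root, root]
    | append_singleton u z ih => rw [label_spec, label_spec, ih, H]
  exact Subtype.ext (RelIso.ext key)

/-- The map of words with prescribed labels. -/
def actFun : (List (Fin d) → Equiv.Perm (Fin d)) → List (Fin d) → List (Fin d)
  | _, [] => []
  | f, x :: v => f [] x :: actFun (fun w => f (x :: w)) v

/-- The inverse of the map of words with prescribed labels. -/
def actInv : (List (Fin d) → Equiv.Perm (Fin d)) → List (Fin d) → List (Fin d)
  | _, [] => []
  | f, y :: v => (f []).symm y :: actInv (fun w => f ((f []).symm y :: w)) v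

theorem actInv_actFun (f : List (Fin d) → Equiv.Perm (Fin d)) (v : List (Fin d)) :
    actInv f (actFun f v) = v := by
  induction v generalizing f with
  | nil => rfl
  | cons x v ih => simp [actFun, actInv, ih]

theorem actFun_actInv (f : List (Fin d) → Equiv.Perm (Fin d)) (v : List (Fin d)) :
    actFun f (actInv f v) = v := by
  induction v generalizing f with
  | nil => rfl
  | cons x v ih => simp [actFun, actInv, ih]

theorem actFun_append_singleton (f : List (Fin d) → Equiv.Perm (Fin d)) (v : List (Fin d))
    (x : Fin d) : actFun f (v ++ [x]) = actFun f v ++ [f v x] := by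
  induction v generalizing f with
  | nil => rfl
  | cons y v ih => simp [actFun, ih]

theorem actInv_append_singleton (f : List (Fin d) → Equiv.Perm (Fin d)) (v : List (Fin d))
    (x : Fin d) : ∃ y, actInv f (v ++ [x]) = actInv f v ++ [y] := by
  induction v generalizing f with
  | nil => exact ⟨_, rfl⟩
  | cons z v ih =>
    obtain ⟨y, hy⟩ := ih (fun w => f ((f []).symm z :: w))
    exact ⟨y, by simp [actInv, hy]⟩

theorem adj_map {f : List (Fin d) → List (Fin d)}
    (hf : ∀ v x, ∃ y, f (v ++ [x]) = f v ++ [y]) {v w : List (Fin d)}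
    (h : (regTree d).Adj v w) : (regTree d).Adj (f v) (f w) := by
  rcases h with ⟨x, rfl⟩ | ⟨x, rfl⟩
  · exact Or.inl (hf v x)
  · exact Or.inr (hf w x)

/-- The automorphism with prescribed labels. -/
def ofLabels (f : List (Fin d) → Equiv.Perm (Fin d)) : AutT d :=
  ⟨{ toFun := actFun f
     invFun := actInv f
     left_inv := actInv_actFun f
     right_inv := actFun_actInv f
     map_rel_iff' := by
      intro v w
      refine ⟨fun h => ?_, adj_map fun v x => ⟨_, actFun_append_singleton f v x⟩⟩
      have := adj_map (actInv_append_singleton f) h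
      simpa [actInv_actFun] using this }, rfl⟩

@[simp] theorem label_ofLabels (f : List (Fin d) → Equiv.Perm (Fin d)) (v : List (Fin d)) :
    label (ofLabels f) v = f v :=
  label_eq _ _ _ (actFun_append_singleton f v)

@[simp] theorem ofLabels_label (g : AutT d) : ofLabels (label g) = g :=
  ext_label fun v => label_ofLabels _ v

theorem ofLabels_cons (f : List (Fin d) → Equiv.Perm (Fin d)) (x : Fin d) (v : List (Fin d)) :
    (ofLabels f).1 (x :: v) = f [] x :: (ofLabels fun w => f (x :: w)).1 v := rfl

theorem ext_app {g h : AutT d} (H : ∀ v, g.1 v = h.1 v) : g = h :=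
  Subtype.ext (RelIso.ext H)

/-- The section of `g` at the letter `x`. -/
noncomputable def sect (g : AutT d) (x : Fin d) : AutT d := ofLabels fun w => label g (x :: w)

theorem app_cons (g : AutT d) (x : Fin d) (v : List (Fin d)) :
    g.1 (x :: v) = label g [] x :: (sect g x).1 v := by
  conv_lhs => rw [← ofLabels_label g]
  rfl

/-- The labels of an automorphism with root label `1` and sections `g x`. -/
noncomputable def nodeLabels (g : Fin d → AutT d) : List (Fin d) → Equiv.Perm (Fin d)
  | [] => 1
  | x :: v => label (g x) v

theorem ofLabels_nodeLabels_cons (g : Fin d → AutT d) (x : Fin d) (v : List (Fin d)) :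
    (ofLabels (nodeLabels g)).1 (x :: v) = x :: (g x).1 v := by
  rw [ofLabels_cons]
  simp [nodeLabels]

/-- The automorphism that fixes the letters and has sections `g x`. -/
noncomputable def node : (Fin d → AutT d) →* AutT d :=
  MonoidHom.mk' (fun g => ofLabels (nodeLabels g)) fun g h => ext_app fun v => by
    cases v with
    | nil => rfl
    | cons x v => simp [ofLabels_nodeLabels_cons]

theorem node_cons (g : Fin d → AutT d) (x : Fin d) (v : List (Fin d)) :
    (node g).1 (x :: v) = x :: (g x).1 v := ofLabels_nodeLabels_cons g x v

@[simp] theorem label_node_nil (g : Fin d → AutT d) : label (node g) [] = 1 :=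
  label_ofLabels _ _

@[simp] theorem label_node_cons (g : Fin d → AutT d) (x : Fin d) (v : List (Fin d)) :
    label (node g) (x :: v) = label (g x) v :=
  label_ofLabels _ _

/-- The automorphism that acts by `q` on the first letter only. -/
noncomputable def rooted : Equiv.Perm (Fin d) →* AutT d :=
  MonoidHom.mk' (fun q => ofLabels fun v => if v = [] then q else 1)
      fun p q => ext_label fun v => by
    cases v with
    | nil => simp [label_mul, root]
    | cons x v => simp [label_mul, ofLabels_cons]

@[simp] theorem label_rooted (q : Equiv.Perm (Fin d)) (v : List (Fin d)) :
    label (rooted q) v = if v = [] then q else 1 := label_ofLabels _ _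

@[simp] theorem rooted_cons (q : Equiv.Perm (Fin d)) (x : Fin d) (v : List (Fin d)) :
    (rooted q).1 (x :: v) = q x :: v := by
  have : sect (rooted q) x = 1 := ext_label fun v => by simp [sect, label_one]
  rw [app_cons, this]
  simp

theorem eq_rooted_mul_node (g : AutT d) : g = rooted (label g []) * node (sect g) :=
  ext_app fun v => by
    cases v with
    | nil => rw [root, root]
    | cons x v => rw [mul_app, node_cons, rooted_cons, app_cons]

theorem rooted_mul_node (q : Equiv.Perm (Fin d)) (g : Fin d → AutT d) :
    rooted q * node g * (rooted q)⁻¹ = node (fun x => g (q⁻¹ x)) := by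
  rw [← map_inv]
  refine ext_app fun v => ?_
  cases v with
  | nil => rw [root, root]
  | cons x v => rw [mul_app, mul_app, rooted_cons, node_cons, rooted_cons, node_cons]; simp

/-- The automorphism acting by `g` below the letter `x`, and trivially elsewhere. -/
noncomputable def below (x : Fin d) : AutT d →* AutT d := 
  node.comp (MonoidHom.mulSingle (fun _ => AutT d) x)

theorem below_apply (x : Fin d) (g : AutT d) : below x g = node (Pi.mulSingle x g) := rfl

/-- Conjugation by a rooted element permutes the sections; for transitive `Q` this moves an element
from below one letter to below any other. -/
theorem rooted_conj_below (q : Equiv.Perm (Fin d)) (x : Fin d) (g : AutT d) :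
    rooted q * below x g * (rooted q)⁻¹ = below (q x) g := by
  rw [below_apply, rooted_mul_node, below_apply]
  congr 1
  funext y
  by_cases h : y = q x
  · subst h; simp
  · have : q⁻¹ y ≠ x := by rintro rfl; simp at h
    simp only [Pi.mulSingle_eq_of_ne h, Pi.mulSingle_eq_of_ne this]

/-- The label at `v` is read off from the children of `v`, which are one level deeper; hence the
shift by one. -/
theorem label_eq_one_of_mem_levelStab {n : ℕ} {g : AutT d} (hg : g ∈ levelStab d (n + 1))
    {v : List (Fin d)} (hv : v.length ≤ n) : label g v = 1 := by
  refine label_eq _ _ _ fun x => ?_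
  have h1 : g ∈ levelStab d (v ++ [x]).length :=
    levelStab_antitone d (by simpa using hv) hg
  have h2 : g ∈ levelStab d v.length := levelStab_antitone d (by omega) hg
  rw [h1 _ rfl, h2 _ rfl]; rfl

/-- Reduces the topology to approximation modulo level stabilizers, the only form in which density
is used below. -/
theorem dense_iff {G : Subgroup (AutT d)} (H : Subgroup G) :
    Dense (H : Set G) ↔ ∀ g ∈ G, ∀ n, ∃ h ∈ H, g⁻¹ * h.1 ∈ levelStab d n := by
  have hb (g : G) : (nhds g).HasBasis (fun _ : ℕ => True)
      fun n => {h : G | (g.1)⁻¹ * h.1 ∈ levelStab d n} := by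
    rw [nhds_subtype_eq_comap]
    have := ((levelBasis d).nhds_hasBasis g.1).comap (Subtype.val : G → AutT d)
    refine this.to_hasBasis ?_ ?_
    · rintro _ ⟨n, rfl⟩
      exact ⟨n, trivial, fun h hh => ⟨_, hh, by simp⟩⟩
    · intro n _
      refine ⟨_, ⟨n, rfl⟩, ?_⟩
      rintro h ⟨k, hk, hkh⟩
      have hkh : g.1 * k = h.1 := hkh
      simpa [← hkh] using hk
  constructor
  · intro hd g hg n
    exact (mem_closure_iff_nhds_basis (hb ⟨g, hg⟩)).1 (hd ⟨g, hg⟩) n trivial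
  · intro H1 g
    exact (mem_closure_iff_nhds_basis (hb g)).2 fun n _ => H1 g g.2 n

/-- The automorphisms all of whose labels lie in `Q`. -/
def labelled (Q : Subgroup (Equiv.Perm (Fin d))) : Subgroup (AutT d) where
  carrier := {g | ∀ v, label g v ∈ Q}
  one_mem' := fun v => by rw [label_one]; exact Q.one_mem
  mul_mem' := fun hg hh v => by rw [label_mul]; exact Q.mul_mem (hg _) (hh _)
  inv_mem' := fun hg v => by rw [label_inv]; exact Q.inv_mem (hg _)

theorem rooted_mem_labelled {Q : Subgroup (Equiv.Perm (Fin d))} {q : Equiv.Perm (Fin d)}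
    (hq : q ∈ Q) : rooted q ∈ labelled Q := fun v => by
  rw [label_rooted]; split_ifs; exacts [hq, Q.one_mem]

theorem node_mem_labelled {Q : Subgroup (Equiv.Perm (Fin d))} {g : Fin d → AutT d}
    (hg : ∀ x, g x ∈ labelled Q) : node g ∈ labelled Q := fun v => by
  cases v with
  | nil => rw [label_node_nil]; exact Q.one_mem
  | cons x v => rw [label_node_cons]; exact hg x v

theorem below_mem_labelled {Q : Subgroup (Equiv.Perm (Fin d))} {g : AutT d} (x : Fin d)
    (hg : g ∈ labelled Q) : below x g ∈ labelled Q := by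
  rw [below_apply]
  refine node_mem_labelled fun y => ?_
  by_cases h : y = x
  · subst h; rw [Pi.mulSingle_eq_same]; exact hg
  · rw [Pi.mulSingle_eq_of_ne h]; exact one_mem _

theorem sect_mem_labelled {Q : Subgroup (Equiv.Perm (Fin d))} {g : AutT d}
    (hg : g ∈ labelled Q) (x : Fin d) : sect g x ∈ labelled Q := fun v => by
  rw [sect, label_ofLabels]; exact hg _

end AutT

/-! ### Obstructions to topological finite generation. -/

/-- Infinitely many homomorphisms from a finite index subgroup to a finite group cannot be told
apart by a finitely generated subgroup. -/
theorem exists_ne_eqOn_of_fg {G A : Type*} [Group G] [Group A] [Finite A] {H N : Subgroup G}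
    (hH : H.FG) [N.FiniteIndex] (φ : ℕ → N →* A) :
    ∃ m n, m ≠ n ∧ ∀ g : N, g.1 ∈ H → φ m g = φ n g := by
  have : Group.FG H := (Group.fg_iff_subgroup_fg H).2 hH
  -- A finite index subgroup of a finitely generated group is finitely generated (Schreier).
  obtain ⟨S, hS, hfin⟩ := (Group.fg_iff (G := N.subgroupOf H)).1 inferInstance
  have : Finite S := hfin
  let ψ : ℕ → N.subgroupOf H →* A := fun i => (φ i).comp (H.subtype.subgroupComap N)
  obtain ⟨m, n, hmn, h⟩ := Finite.exists_ne_map_eq_of_infinite fun i (s : S) => ψ i s.1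
  refine ⟨m, n, hmn, fun g hg => ?_⟩
  have h2 : ψ m = ψ n := MonoidHom.eq_of_eqOn_dense hS fun s hs => congrFun h ⟨s, hs⟩
  exact DFunLike.congr_fun h2 ⟨⟨g.1, hg⟩, g.2⟩

namespace AutT

variable {d : ℕ}

theorem mem_labelled_of_label_nil_mem {Q P : Subgroup (Equiv.Perm (Fin d))}
    {hN : (Q.subgroupOf P).Normal} {g : AutT d} (hg : g ∈ GQP Q P hN) (h : label g [] ∈ Q) :
    g ∈ labelled Q := fun v => by
  simpa using Q.mul_mem (hg.2 v []) h

/-- The label at the root, as a homomorphism. -/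
noncomputable def rootLabel : AutT d →* Equiv.Perm (Fin d) :=
  MonoidHom.mk' (fun g => label g []) fun g h => by rw [label_mul, root]

/-- Within `GQP` all labels lie in one coset of `Q`, so the root label alone decides membership in
`labelled Q`, and it takes finitely many values. -/
theorem finiteIndex_labelled_subgroupOf (Q P : Subgroup (Equiv.Perm (Fin d)))
    (hN : (Q.subgroupOf P).Normal) : ((labelled Q).subgroupOf (GQP Q P hN)).FiniteIndex := by
  have h : (labelled Q).subgroupOf (GQP Q P hN) =
      Q.comap (rootLabel.comp (GQP Q P hN).subtype) := by
    ext g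
    exact ⟨fun h => h [], fun h => mem_labelled_of_label_nil_mem g.2 h⟩
  rw [h]
  refine ⟨?_⟩
  rw [Subgroup.index_comap]
  exact Subgroup.FiniteIndex.index_ne_zero

theorem labelled_le_GQP {Q P : Subgroup (Equiv.Perm (Fin d))} (hQP : Q ≤ P)
    (hN : (Q.subgroupOf P).Normal) : labelled Q ≤ GQP Q P hN := fun _ hg =>
  ⟨fun v => hQP (hg v), fun v w => Q.mul_mem (hg v) (Q.inv_mem (hg w))⟩

theorem not_topFG_of_homs {Q P : Subgroup (Equiv.Perm (Fin d))} (hQP : Q ≤ P)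
    (hN : (Q.subgroupOf P).Normal) {A : Type*} [Group A] [Finite A]
    (φ : ℕ → labelled Q →* A)
    (hker : ∀ n, ∀ g : labelled Q, g.1 ∈ levelStab d (n + 1) → φ n g = 1)
    (hne : ∀ m n, m ≠ n → ∃ g, φ m g ≠ φ n g) : ¬ TopFG (GQP Q P hN) := by
  rintro ⟨H, hH, hdense⟩
  have := finiteIndex_labelled_subgroupOf Q P hN
  obtain ⟨m, n, hmn, heq⟩ := exists_ne_eqOn_of_fg
    (N := (labelled Q).subgroupOf (GQP Q P hN)) hH
    (fun i => (φ i).comp ((GQP Q P hN).subtype.subgroupComap (labelled Q)))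
  obtain ⟨g, hg⟩ := hne m n hmn
  -- Depth `max m n + 1` is in the kernel of both `φ m` and `φ n`, and being positive it also forces
  -- `h` to share the root label of `g`.
  obtain ⟨h, hh, hgh⟩ := (dense_iff H).1 hdense g (labelled_le_GQP hQP hN g.2) (max m n + 1)
  have h1 : label h.1 [] = label g.1 [] := by
    have := label_eq_one_of_mem_levelStab hgh (v := []) (by simp)
    rw [label_mul, root, label_inv, root, inv_mul_eq_one] at this
    exact this.symm
  have hQ : h.1 ∈ labelled Q := mem_labelled_of_label_nil_mem h.2 (h1 ▸ g.2 [])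
  have key : ∀ i, i ≤ max m n → φ i ⟨h.1, hQ⟩ = φ i g := by
    intro i hi
    have := hker i (g⁻¹ * ⟨h.1, hQ⟩) (levelStab_antitone d (by omega) hgh)
    rw [map_mul, map_inv, inv_mul_eq_one] at this
    exact this.symm
  apply hg
  rw [← key m (le_max_left _ _), ← key n (le_max_right _ _)]
  exact heq ⟨h, hQ⟩ hh

/-- The automorphism with the label `q` at `u` and trivial labels elsewhere. -/
noncomputable def singleLabel (u : List (Fin d)) (q : Equiv.Perm (Fin d)) : AutT d :=
  ofLabels fun v => if v = u then q else 1

theorem label_singleLabel (u v : List (Fin d)) (q : Equiv.Perm (Fin d)) :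
    label (singleLabel u q) v = if v = u then q else 1 := label_ofLabels _ _

theorem singleLabel_mem_labelled {Q : Subgroup (Equiv.Perm (Fin d))} {q : Equiv.Perm (Fin d)}
    (hq : q ∈ Q) (u : List (Fin d)) : singleLabel u q ∈ labelled Q := fun v => by
  rw [label_singleLabel]; split_ifs; exacts [hq, Q.one_mem]

/-- The label at `v` of an automorphism all of whose labels lie in `Q`. -/
noncomputable def labelIn {Q : Subgroup (Equiv.Perm (Fin d))} (g : labelled Q) (v : List (Fin d)) :
    Q := ⟨label g.1 v, g.2 v⟩

theorem labelIn_mul {Q : Subgroup (Equiv.Perm (Fin d))} (g h : labelled Q) (v : List (Fin d)) :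
    labelIn (g * h) v = labelIn g (h.1.1 v) * labelIn h v := Subtype.ext (label_mul _ _ _)

theorem app_replicate {Q : Subgroup (Equiv.Perm (Fin d))} {x : Fin d} (hx : ∀ q ∈ Q, q x = x)
    {g : AutT d} (hg : g ∈ labelled Q) (n : ℕ) :
    g.1 (List.replicate n x) = List.replicate n x := by
  induction n with
  | zero => exact root g
  | succ n ih => rw [List.replicate_succ', label_spec, ih, hx _ (hg _)]

/-- Every element of `labelled Q` fixes the words `xⁿ`, so taking the label there is multiplicative;
a single nontrivial label at `xᵐ` separates these homomorphisms. -/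
theorem not_topFG_of_fixed {Q P : Subgroup (Equiv.Perm (Fin d))} (hQ : Q ≠ ⊥) (hQP : Q ≤ P)
    (hN : (Q.subgroupOf P).Normal) {x : Fin d} (hx : ∀ q ∈ Q, q x = x) :
    ¬ TopFG (GQP Q P hN) := by
  obtain ⟨q, hq, hq1⟩ := Q.bot_or_exists_ne_one.resolve_left hQ
  refine not_topFG_of_homs hQP hN
    (fun n => MonoidHom.mk' (fun g : labelled Q => labelIn g (List.replicate n x)) fun g h => by
      rw [labelIn_mul, app_replicate hx h.2])
    (fun n g hg => Subtype.ext (label_eq_one_of_mem_levelStab hg (by simp)))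
    fun m n hmn => ⟨⟨singleLabel (List.replicate m x) q, singleLabel_mem_labelled hq _⟩, ?_⟩
  intro h
  have h := congrArg Subtype.val h
  simp only [MonoidHom.mk'_apply, labelIn, label_singleLabel] at h
  rw [if_pos trivial, if_neg fun e => hmn (by simpa using (congrArg List.length e).symm)] at h
  exact hq1 h

/-- The permutation induced on a level. -/
def levelPerm (g : AutT d) (n : ℕ) : List.Vector (Fin d) n ≃ List.Vector (Fin d) n where
  toFun v := ⟨g.1 v.1, (length_app g _).trans v.2⟩
  invFun v := ⟨(g⁻¹).1 v.1, (length_app _ _).trans v.2⟩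
  left_inv _ := Subtype.ext (inv_app_self g _)
  right_inv _ := Subtype.ext (app_inv_self g _)

/-- The product of the labels at the level `n`, in the abelianization. -/
noncomputable def levelProd (Q : Subgroup (Equiv.Perm (Fin d))) (n : ℕ) :
    labelled Q →* Abelianization Q :=
  MonoidHom.mk' (fun g => ∏ v : List.Vector (Fin d) n, Abelianization.of (labelIn g v.1))
    fun g h => by
      simp only [labelIn_mul, map_mul, Finset.prod_mul_distrib]
      congr 1
      -- The labels of `g` are evaluated at the images under `h`; reindexing the level by `h`
      -- removes this twist.
      exact (levelPerm h.1 n).prod_comp fun v => Abelianization.of (labelIn g v.1)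

theorem levelProd_apply (Q : Subgroup (Equiv.Perm (Fin d))) (n : ℕ) (g : labelled Q) :
    levelProd Q n g = ∏ v : List.Vector (Fin d) n, Abelianization.of (labelIn g v.1) := rfl

/-- An element with one label outside `⁅Q, Q⁆`, at level `m`, is detected by `levelProd Q m` and by
no other level. -/
theorem not_topFG_of_not_perfect (hd : 0 < d) {Q P : Subgroup (Equiv.Perm (Fin d))} (hQP : Q ≤ P)
    (hN : (Q.subgroupOf P).Normal) (hQ : Q ≠ ⁅Q, Q⁆) : ¬ TopFG (GQP Q P hN) := by
  obtain ⟨q, hq, hq'⟩ : ∃ q ∈ Q, q ∉ ⁅Q, Q⁆ := by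
    by_contra! h
    exact hQ (le_antisymm h (Subgroup.commutator_le_self Q))
  have hq1 : Abelianization.of (⟨q, hq⟩ : Q) ≠ 1 := by
    intro h
    rw [← MonoidHom.mem_ker, Abelianization.ker_of] at h
    apply hq'
    rw [← Subgroup.map_subtype_commutator]
    exact ⟨_, h, rfl⟩
  have : Finite (Abelianization Q) := Finite.of_surjective _ (QuotientGroup.mk_surjective)
  refine not_topFG_of_homs hQP hN (levelProd Q) (fun n g hg => ?_) fun m n hmn => ?_
  · rw [levelProd_apply]
    refine Finset.prod_eq_one fun v _ => ?_
    have : labelIn g v.1 = 1 := Subtype.ext (label_eq_one_of_mem_levelStab hg v.2.le)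
    rw [this, map_one]
  · let u : List.Vector (Fin d) m := List.Vector.replicate m ⟨0, hd⟩
    refine ⟨⟨singleLabel u.1 q, singleLabel_mem_labelled hq _⟩, fun h => hq1 ?_⟩
    rw [levelProd_apply, levelProd_apply, Finset.prod_eq_single u, Finset.prod_eq_one] at h
    · have : labelIn ⟨singleLabel u.1 q, singleLabel_mem_labelled hq _⟩ u.1 = ⟨q, hq⟩ :=
        Subtype.ext (by simp [labelIn, label_singleLabel])
      rwa [this] at h
    · intro v _
      have hv : v.1 ≠ u.1 := fun e =>
        hmn ((u.2.symm.trans (congrArg List.length e).symm).trans v.2)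
      have : labelIn ⟨singleLabel u.1 q, singleLabel_mem_labelled hq _⟩ v.1 = 1 :=
        Subtype.ext (by simp [labelIn, label_singleLabel, hv])
      rw [this, map_one]
    · intro v _ hv
      have hv' : v.1 ≠ u.1 := fun e => hv (Subtype.ext e)
      have : labelIn ⟨singleLabel u.1 q, singleLabel_mem_labelled hq _⟩ v.1 = 1 :=
        Subtype.ext (by simp [labelIn, label_singleLabel, hv'])
      rw [this, map_one]
    · simp

end AutT

/-! ### A finitely generated dense subgroup for perfect transitive `Q`. -/

namespace AutT

open scoped commutatorElement

variable {d : ℕ}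

theorem node_mem_levelStab {n : ℕ} {g : Fin d → AutT d} (hg : ∀ x, g x ∈ levelStab d n) :
    node g ∈ levelStab d (n + 1) := fun v hv => by
  cases v with
  | nil => simp at hv
  | cons x v => rw [node_cons, hg x v (by simpa using hv)]

/-- Write an element as its root label times its sections, and approximate each section one level
less deeply. -/
theorem exists_approx {Q : Subgroup (Equiv.Perm (Fin d))} {H : Subgroup (AutT d)}
    (hroot : ∀ q ∈ Q, rooted q ∈ H) (hbelow : ∀ x, ∀ h ∈ H, below x h ∈ H) (n : ℕ) :
    ∀ g ∈ labelled Q, ∃ h ∈ H, g⁻¹ * h ∈ levelStab d n := by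
  induction n with
  | zero =>
    refine fun g _ => ⟨1, H.one_mem, fun v hv => ?_⟩
    rw [List.length_eq_zero_iff.1 hv, root]
  | succ n ih =>
    intro g hg
    choose h hh hs using fun x => ih (sect g x) (sect_mem_labelled hg x)
    refine ⟨rooted (label g []) * node h, H.mul_mem (hroot _ (hg [])) ?_, ?_⟩
    · exact Subgroup.pi_mem_of_mulSingle_mem (H := H.comap node) h fun x => hbelow x _ (hh x)
    · have : g⁻¹ * (rooted (label g []) * node h) = node ((sect g)⁻¹ * h) := by
        conv_lhs => enter [1]; rw [eq_rooted_mul_node g]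
        rw [map_mul, map_inv]
        group
      rw [this]
      exact node_mem_levelStab hs

/-- The labels of `spinal`. -/
def spinalLabels (x₀ x₁ : Fin d) (q : Equiv.Perm (Fin d)) :
    Bool → List (Fin d) → Equiv.Perm (Fin d)
  | _, [] => 1
  | e, x :: v => if x = x₀ then spinalLabels x₀ x₁ q (!e) v
      else if e = true ∧ x = x₁ ∧ v = [x₁] then q else 1

/-- The automorphism with the labels `q` at the words `x₀ⁿ x₁ x₁`, where `n` is even if `e` is
true and odd otherwise, and trivial labels elsewhere. -/
noncomputable def spinal (x₀ x₁ : Fin d) (e : Bool) (q : Equiv.Perm (Fin d)) : AutT d :=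
  ofLabels (spinalLabels x₀ x₁ q e)

theorem spinal_mem_labelled {Q : Subgroup (Equiv.Perm (Fin d))} {q : Equiv.Perm (Fin d)}
    (hq : q ∈ Q) (x₀ x₁ : Fin d) (e : Bool) : spinal x₀ x₁ e q ∈ labelled Q := fun v => by
  rw [spinal, label_ofLabels]
  induction v generalizing e with
  | nil => exact Q.one_mem
  | cons x v ih =>
    rw [spinalLabels]
    split_ifs
    exacts [ih _, hq, Q.one_mem]

theorem spinal_false (x₀ x₁ : Fin d) (q : Equiv.Perm (Fin d)) :
    spinal x₀ x₁ false q = below x₀ (spinal x₀ x₁ true q) := ext_label fun v => by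
  rw [below_apply]
  cases v with
  | nil => simp [spinal, spinalLabels]
  | cons x v =>
    by_cases h : x = x₀
    · subst h; simp [spinal, spinalLabels]
    · simp [spinal, spinalLabels, h, label_one]

theorem label_below_rooted (x : Fin d) (q : Equiv.Perm (Fin d)) (v : List (Fin d)) :
    label (below x (rooted q)) v = if v = [x] then q else 1 := by
  rw [below_apply]
  cases v with
  | nil => simp
  | cons y v =>
    by_cases h : y = x
    · subst h; simp
    · simp [h, label_one]

theorem spinal_true (x₀ x₁ : Fin d) (q : Equiv.Perm (Fin d)) :
    spinal x₀ x₁ true q = node fun x => if x = x₀ then spinal x₀ x₁ false q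
      else if x = x₁ then below x₁ (rooted q) else 1 := ext_label fun v => by
  cases v with
  | nil => simp [spinal, spinalLabels]
  | cons x v =>
    rw [label_node_cons]
    split_ifs with h h'
    · simp [spinal, spinalLabels, h]
    · subst h'; simp [spinal, spinalLabels, h, label_below_rooted]
    · simp [spinal, spinalLabels, h, h', label_one]

theorem spinal_true_eq_mul {x₀ x₁ : Fin d} (hx : x₁ ≠ x₀) (q : Equiv.Perm (Fin d)) :
    spinal x₀ x₁ true q = below x₀ (spinal x₀ x₁ false q) * below x₁ (below x₁ (rooted q)) := by
  rw [spinal_true, below_apply x₀, below_apply x₁ (below _ _), ← map_mul]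
  congr 1
  funext x
  rw [Pi.mul_apply]
  split_ifs with h h'
  · subst h; simp [hx.symm]
  · subst h'; simp [hx]
  · simp [h, h']

theorem commute_below {x y : Fin d} (h : x ≠ y) (g k : AutT d) :
    Commute (below x g) (below y k) :=
  (Pi.mulSingle_commute (f := fun _ => AutT d) h g k).map node

/-- Below `x₁` the two sections carry `p` and `q` and give their commutator. Below `x₀` the sections
are `spinal_false` elements, supported below `x₀` only; this is the purpose of the alternating
parity. Conjugation by `r` moves one support to `r x₀ ≠ x₀`, so they commute and nothing survives
there. -/
theorem commutator_spinal {x₀ x₁ : Fin d} (hx : x₁ ≠ x₀) {r : Equiv.Perm (Fin d)}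
    (hr : r x₀ ≠ x₀) (p q : Equiv.Perm (Fin d)) :
    ⁅spinal x₀ x₁ true p,
      below x₀ (rooted r) * spinal x₀ x₁ true q * (below x₀ (rooted r))⁻¹⁆ =
    below x₁ (below x₁ (rooted ⁅p, q⁆)) := by
  rw [below_apply x₁ (below _ _), below_apply x₀, spinal_true, spinal_true, ← map_inv, ← map_mul,
    ← map_mul, ← map_commutatorElement]
  congr 1
  funext x
  simp only [commutatorElement_def, Pi.mul_apply, Pi.inv_apply]
  by_cases h : x = x₀
  · subst h
    rw [Pi.mulSingle_eq_of_ne hx.symm, Pi.mulSingle_eq_same, if_pos rfl, if_pos rfl, spinal_false,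
      spinal_false, rooted_conj_below, ← commutatorElement_def,
      commutatorElement_eq_one_iff_commute]
    exact commute_below hr.symm _ _
  · by_cases h' : x = x₁
    · subst h'
      simp [h]
    · simp [h, h']

/-- Generators of a dense subgroup of `labelled Q`. -/
def spinalGens (Q : Subgroup (Equiv.Perm (Fin d))) (x₀ x₁ : Fin d) : Set (AutT d) :=
  rooted '' Q ∪ (⋃ x, (fun q => below x (rooted q)) '' Q) ∪ ⋃ e, spinal x₀ x₁ e '' Q

theorem finite_spinalGens (Q : Subgroup (Equiv.Perm (Fin d))) (x₀ x₁ : Fin d) :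
    (spinalGens Q x₀ x₁).Finite :=
  have hQ : (Q : Set (Equiv.Perm (Fin d))).Finite := Set.toFinite _
  ((hQ.image _).union (Set.finite_iUnion fun _ => hQ.image _)).union
    (Set.finite_iUnion fun _ => hQ.image _)

section Perfect

variable {Q : Subgroup (Equiv.Perm (Fin d))} {x₀ x₁ : Fin d}

theorem rooted_mem_closure {q : Equiv.Perm (Fin d)} (hq : q ∈ Q) :
    rooted q ∈ Subgroup.closure (spinalGens Q x₀ x₁) :=
  Subgroup.subset_closure (.inl (.inl ⟨q, hq, rfl⟩))

theorem below_rooted_mem_closure (x : Fin d) {q : Equiv.Perm (Fin d)} (hq : q ∈ Q) :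
    below x (rooted q) ∈ Subgroup.closure (spinalGens Q x₀ x₁) :=
  Subgroup.subset_closure (.inl (.inr (Set.mem_iUnion.2 ⟨x, q, hq, rfl⟩)))

theorem spinal_mem_closure (e : Bool) {q : Equiv.Perm (Fin d)} (hq : q ∈ Q) :
    spinal x₀ x₁ e q ∈ Subgroup.closure (spinalGens Q x₀ x₁) :=
  Subgroup.subset_closure (.inr (Set.mem_iUnion.2 ⟨e, q, hq, rfl⟩))

theorem below_mem_closure_of_transitive (htr : ∀ x y, ∃ q ∈ Q, q x = y) {y : Fin d} {g : AutT d}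
    (hg : below y g ∈ Subgroup.closure (spinalGens Q x₀ x₁)) (x : Fin d) :
    below x g ∈ Subgroup.closure (spinalGens Q x₀ x₁) := by
  obtain ⟨q, hq, rfl⟩ := htr y x
  rw [← rooted_conj_below]
  exact mul_mem (mul_mem (rooted_mem_closure hq) hg) (inv_mem (rooted_mem_closure hq))

/-- Commutators of spinal generators isolate a label at `x₁x₁`, perfectness makes it an arbitrary
element of `Q`, and transitivity at both levels moves it to the other words of length two. -/
theorem below_below_rooted_mem_closure (htr : ∀ x y, ∃ q ∈ Q, q x = y) (hQ : Q = ⁅Q, Q⁆)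
    (hx : x₁ ≠ x₀) (x y : Fin d) {q : Equiv.Perm (Fin d)} (hq : q ∈ Q) :
    below x (below y (rooted q)) ∈ Subgroup.closure (spinalGens Q x₀ x₁) := by
  refine below_mem_closure_of_transitive htr (y := x₁) ?_ x
  obtain ⟨r, hr, hrx⟩ := htr x₀ x₁
  have key : Q ≤ (Subgroup.closure (spinalGens Q x₀ x₁)).comap
      ((below x₁).comp ((below x₁).comp rooted)) := by
    -- Perfectness enters here: it suffices to treat commutators.
    conv_lhs => rw [hQ]
    refine Subgroup.commutator_le.2 fun p hp q hq => ?_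
    change below x₁ (below x₁ (rooted ⁅p, q⁆)) ∈ Subgroup.closure (spinalGens Q x₀ x₁)
    rw [← commutator_spinal hx (hrx.trans_ne hx), commutatorElement_def]
    have h1 := spinal_mem_closure (x₀ := x₀) (x₁ := x₁) true hp
    have h2 := spinal_mem_closure (x₀ := x₀) (x₁ := x₁) true hq
    have h3 := below_rooted_mem_closure (x₀ := x₀) (x₁ := x₁) x₀ hr
    have h4 := mul_mem (mul_mem h3 h2) (inv_mem h3)
    exact mul_mem (mul_mem (mul_mem h1 h4) (inv_mem h1)) (inv_mem h4)
  obtain ⟨s, hs, rfl⟩ := htr x₁ y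
  have h1 := below_rooted_mem_closure (x₀ := x₀) (x₁ := x₁) x₁ hs
  rw [← rooted_conj_below, map_mul, map_mul, map_inv]
  exact mul_mem (mul_mem h1 (key hq)) (inv_mem h1)

/-- Self-similarity is checked on generators. Pushing a spinal element below `x₀` exchanges the two
parities, up to a label at `x₁x₁` that is already available. -/
theorem below_mem_closure (htr : ∀ x y, ∃ q ∈ Q, q x = y) (hQ : Q = ⁅Q, Q⁆) (hx : x₁ ≠ x₀)
    (x : Fin d) {g : AutT d} (hg : g ∈ Subgroup.closure (spinalGens Q x₀ x₁)) :
    below x g ∈ Subgroup.closure (spinalGens Q x₀ x₁) := by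
  suffices h : Subgroup.closure (spinalGens Q x₀ x₁) ≤
      (Subgroup.closure (spinalGens Q x₀ x₁)).comap (below x) from h hg
  refine (Subgroup.closure_le _).2 ?_
  rintro _ ((⟨q, hq, rfl⟩ | h) | h)
  · exact below_rooted_mem_closure x hq
  · obtain ⟨y, q, hq, rfl⟩ := Set.mem_iUnion.1 h
    exact below_below_rooted_mem_closure htr hQ hx x y hq
  · obtain ⟨e, q, hq, rfl⟩ := Set.mem_iUnion.1 h
    refine below_mem_closure_of_transitive htr (y := x₀) ?_ x
    cases e with
    | true => rw [← spinal_false]; exact spinal_mem_closure _ hq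
    | false =>
      rw [← mul_inv_eq_of_eq_mul (spinal_true_eq_mul hx q)]
      exact mul_mem (spinal_mem_closure _ hq)
        (inv_mem (below_below_rooted_mem_closure htr hQ hx _ _ hq))

theorem closure_spinalGens_le :
    Subgroup.closure (spinalGens Q x₀ x₁) ≤ labelled Q := by
  refine (Subgroup.closure_le _).2 ?_
  rintro _ ((⟨q, hq, rfl⟩ | h) | h)
  · exact rooted_mem_labelled hq
  · obtain ⟨y, q, hq, rfl⟩ := Set.mem_iUnion.1 h
    exact below_mem_labelled y (rooted_mem_labelled hq)
  · obtain ⟨e, q, hq, rfl⟩ := Set.mem_iUnion.1 h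
    exact spinal_mem_labelled hq _ _ _

end Perfect

theorem topFG_of_perfect {Q P : Subgroup (Equiv.Perm (Fin d))} (hQP : Q ≤ P)
    (hN : (Q.subgroupOf P).Normal) (htr : ∀ x y, ∃ q ∈ Q, q x = y) (hQ : Q = ⁅Q, Q⁆)
    {x₀ x₁ : Fin d} (hx : x₁ ≠ x₀) : TopFG (GQP Q P hN) := by
  -- Constant labellings represent the cosets of `labelled Q`: dividing `g` by the one with its root
  -- label leaves all labels in `Q`.
  let c : Equiv.Perm (Fin d) → AutT d := fun p => ofLabels fun _ => p
  let H := Subgroup.closure (spinalGens Q x₀ x₁ ∪ c '' P)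
  have hfin : (spinalGens Q x₀ x₁ ∪ c '' P).Finite :=
    (finite_spinalGens Q x₀ x₁).union ((Set.toFinite _).image _)
  have hle₀ : Subgroup.closure (spinalGens Q x₀ x₁) ≤ H :=
    Subgroup.closure_mono Set.subset_union_left
  have hle : H ≤ GQP Q P hN := by
    rw [show H = _ from Subgroup.closure_union _ _]
    refine sup_le (closure_spinalGens_le.trans (labelled_le_GQP hQP hN))
      ((Subgroup.closure_le _).2 ?_)
    rintro _ ⟨p, hp, rfl⟩
    refine ⟨fun v => ?_, fun v w => ?_⟩
    · simpa [c] using hp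
    · simp [c]
  refine ⟨H.subgroupOf (GQP Q P hN), ?_, (dense_iff _).2 fun g hg n => ?_⟩
  · have : Group.FG H := (Group.fg_iff_subgroup_fg H).2 ((Subgroup.fg_iff H).2 ⟨_, rfl, hfin⟩)
    exact (Group.fg_iff_subgroup_fg _).1
      (Group.fg_of_surjective (f := (Subgroup.subgroupOfEquivOfLe hle).symm.toMonoidHom)
        (MulEquiv.surjective _))
  · have hc : c (label g [])⁻¹ ∈ H :=
      Subgroup.subset_closure (.inr ⟨_, P.inv_mem (hg.1 []), rfl⟩)
    have hw : g * c (label g [])⁻¹ ∈ labelled Q := fun v => by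
      rw [label_mul, label_ofLabels]
      exact hg.2 _ _
    obtain ⟨h, hh, hs⟩ := exists_approx (fun q hq => rooted_mem_closure hq)
      (fun x g hg => below_mem_closure htr hQ hx x hg) n _ hw
    have hmem : h * (c (label g [])⁻¹)⁻¹ ∈ H := H.mul_mem (hle₀ hh) (H.inv_mem hc)
    refine ⟨⟨_, hle hmem⟩, hmem, ?_⟩
    -- The approximation is for `g * c (label g [])⁻¹`; normality of the level stabilizer allows the
    -- constant factor to be moved across.
    have := (levelStab_normal d n).conj_mem _ hs (c (label g [])⁻¹)
    convert this using 1
    group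

end AutT

theorem mainTheorem8 (d : ℕ) (hd : 2 ≤ d) (Q P : Subgroup (Equiv.Perm (Fin d)))
    (hQ : Q ≠ ⊥) (hQP : Q ≤ P) (hN : (Q.subgroupOf P).Normal) :
    ((Q ≠ ⁅Q, Q⁆ ∨ ∃ x : Fin d, ∀ q ∈ Q, q x = x) → ¬ TopFG (GQP Q P hN)) ∧
    (MulAction.IsPretransitive Q (Fin d) → (TopFG (GQP Q P hN) ↔ Q = ⁅Q, Q⁆)) := by
  refine ⟨?_, fun htr => ⟨fun h => ?_, fun h => ?_⟩⟩
  · rintro (h | ⟨x, hx⟩)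
    · exact AutT.not_topFG_of_not_perfect (by omega) hQP hN h
    · exact AutT.not_topFG_of_fixed hQ hQP hN hx
  · by_contra hne
    exact AutT.not_topFG_of_not_perfect (by omega) hQP hN hne h
  · refine AutT.topFG_of_perfect hQP hN (fun x y => ?_) h
      (x₀ := ⟨0, by omega⟩) (x₁ := ⟨1, by omega⟩) (by simp)
    obtain ⟨q, hq⟩ := htr.exists_smul_eq x y
    exact ⟨q.1, q.2, hq⟩
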